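/- Fix a finite alphabet $A$. For languages $K,L\subseteq A^*$, a word $u\in A^*$ and a letter $a\in A$, write $u^{-1}L=\{w\in A^*\mid uw\in L\}$, $Lu^{-1}=\{w\in A^*\mid wu\in L\}$ and $KaL=\{xay\mid x\in K,\ y\in L\}$. A class (set) $\mathcal{C}$ of languages over $A$ is a \emph{quotienting lattice of regular languages} if all its members are regular, $\emptyset,A^*\in\mathcal{C}$, it is closed under union and intersection, and $u^{-1}L,\,Lu^{-1}\in\mathcal{C}$ for all $L\in\mathcal{C}$ and $u\in A^*$. The polynomial closure $\mathrm{Pol}(\mathcal{C})$ is the smallest class containing $\mathcal{C}$ such that $H\cup L$ and $HaL$ belong to it whenever $H$ and $L$ do and $a\in A$. Moreover, $\text{co-}\mathrm{Pol}(\mathcal{C})=\{L\subseteq A^*\mid A^*\setminus L\in\mathrm{Pol}(\mathcal{C})\}$. For a regular language $L$, let $\alpha_L:A^*\to M_L=A^*/{\equiv_L}$ be its syntactic morphism, where $u\equiv_L v$ iff for all $x,y\in A^*$ ($xuy\in L\Leftrightarrow xvy\in L$). The monoid $M_L$ is finite and is ordered by the syntactic order: $s\leq_L t$ iff for all $x,y\in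 M_L$, $xsy\in\alpha_L(L)$ implies $xty\in\alpha_L(L)$. Let $\omega\geq 1$ be an integer such that $s^\omega$ is idempotent for every $s\in M_L$ (the elements $s^\omega$ and $s^{\omega+1}$ do not depend on its choice). A pair $(s,t)\in M_L^2$ is a \emph{$\mathcal{C}$-pair} (for $\alpha_L$) if there is no $K\in\mathcal{C}$ with $\alpha_L^{-1}(s)\subseteq K$ and $\alpha_L^{-1}(t)\cap K=\emptyset$. \textbf{Corollary.} Let $\mathcal{C}$ be a quotienting lattice of regular languages and let $L$ be a regular language, both over $A$. Then the following three properties are equivalent: \begin{enumerate} \item $L\in\text{co-}\mathrm{Pol}(\mathcal{C})$. \item $s^{\omega}ts^{\omega}\leq_L s^{\omega+1}$ for all $\mathcal{C}$-pairs $(s,t)\in M_L^2$. \item $ete\leq_L e$ for all $\mathcal{C}$-pairs $(e,t)\in M_L^2$ with $e$ idempotent. \end{enumerate} -/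

import Mathlib

namespace PolynomialClosure

/-! ### Classes of languages -/

/-- The right quotient `L u⁻¹ = {w | w u ∈ L}` (the left quotient `u⁻¹ L` is
`Language.leftQuotient`). -/
def rightQuotient {A : Type*} (L : Language A) (u : List A) : Language A :=
  {w : List A | w ++ u ∈ L}

/-- A class of languages over `A` is a lattice when it contains `∅` and `A*` and is closed under
(binary) union and intersection. -/
structure IsLatticeClass {A : Type*} (C : Set (Language A)) : Prop where
  empty_mem : (⊥ : Language A) ∈ C
  univ_mem : (⊤ : Language A) ∈ C
  union_mem : ∀ K ∈ C, ∀ L ∈ C, K ⊔ L ∈ C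
  inter_mem : ∀ K ∈ C, ∀ L ∈ C, K ⊓ L ∈ C

/-- A class of languages is quotienting when it is closed under left and right quotients by
words. -/
structure IsQuotientingClass {A : Type*} (C : Set (Language A)) : Prop where
  leftQuotient_mem : ∀ L ∈ C, ∀ u : List A, L.leftQuotient u ∈ C
  rightQuotient_mem : ∀ L ∈ C, ∀ u : List A, rightQuotient L u ∈ C

/-- A quotienting lattice of regular languages. -/
structure IsRegularQuotientingLattice {A : Type*} (C : Set (Language A)) : Prop where
  isLattice : IsLatticeClass C
  isQuotienting : IsQuotientingClass C
  isRegular : ∀ L ∈ C, L.IsRegular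

/-- The marked concatenation `K a L`. -/
def markedConcat {A : Type*} (K : Language A) (a : A) (L : Language A) : Language A :=
  K * ({[a]} : Language A) * L

/-- Membership in the polynomial closure of `C`: the smallest class containing `C` and closed
under marked concatenation and union. -/
inductive MemPol {A : Type*} (C : Set (Language A)) : Language A → Prop
  | base (L : Language A) : L ∈ C → MemPol C L
  | marked (H : Language A) (a : A) (L : Language A) :
      MemPol C H → MemPol C L → MemPol C (markedConcat H a L)
  | union (H L : Language A) : MemPol C H → MemPol C L → MemPol C (H ⊔ L)

/-- The polynomial closure `Pol(C)`. -/
def Pol {A : Type*} (C : Set (Language A)) : Set (Language A) := {L | MemPol C L}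

/-- The class `co-Pol(C)` of all complements of languages in `Pol(C)`. -/
def coPol {A : Type*} (C : Set (Language A)) : Set (Language A) := {L | Lᶜ ∈ Pol C}

/-! ### Separation and `C`-pairs -/

/-- `K` separates `L₁` from `L₂` when `L₁ ⊆ K` and `L₂ ∩ K = ∅`. -/
def Separates {A : Type*} (K L₁ L₂ : Language A) : Prop := L₁ ≤ K ∧ L₂ ⊓ K = ⊥

/-- `L₁` is `C`-separable from `L₂` when some language of `C` separates `L₁` from `L₂`. -/
def Separable {A : Type*} (C : Set (Language A)) (L₁ L₂ : Language A) : Prop :=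
  ∃ K ∈ C, Separates K L₁ L₂

/-- The language `α⁻¹(s)`. -/
def fiber {A M : Type*} [Monoid M] (α : FreeMonoid A →* M) (s : M) : Language A :=
  {w : List A | α (FreeMonoid.ofList w) = s}

/-- `(s, t)` is a `C`-pair for the morphism `α : A* → M` when `α⁻¹(s)` is not `C`-separable from
`α⁻¹(t)`. -/
def IsCPair {A M : Type*} [Monoid M] (C : Set (Language A)) (α : FreeMonoid A →* M)
    (s t : M) : Prop :=
  ¬ Separable C (fiber α s) (fiber α t)

/-! ### The syntactic ordered monoid -/

/-- The syntactic congruence of `L`. -/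
def syntacticCon {A : Type*} (L : Language A) : Con (FreeMonoid A) where
  r u v := ∀ x y : FreeMonoid A, (x * u * y).toList ∈ L ↔ (x * v * y).toList ∈ L
  iseqv := ⟨fun _ _ _ => Iff.rfl, fun h x y => (h x y).symm,
    fun h₁ h₂ x y => (h₁ x y).trans (h₂ x y)⟩
  mul' := by
    intro u u' v v' h₁ h₂ x y
    have e₁ := h₁ x (v * y)
    have e₂ := h₂ (x * u') y
    simp only [mul_assoc] at e₁ e₂ ⊢
    exact e₁.trans e₂

/-- The syntactic monoid `M_L = A* / ≡_L`. -/
def SyntacticMonoid {A : Type*} (L : Language A) : Type _ := (syntacticCon L).Quotient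

instance instMonoidSyntacticMonoid {A : Type*} (L : Language A) : Monoid (SyntacticMonoid L) :=
  inferInstanceAs (Monoid (syntacticCon L).Quotient)

/-- The syntactic morphism `α_L : A* → M_L`. -/
def syntacticHom {A : Type*} (L : Language A) : FreeMonoid A →* SyntacticMonoid L :=
  (syntacticCon L).mk'

theorem syntacticHom_surjective {A : Type*} (L : Language A) :
    Function.Surjective (syntacticHom L) := Con.mk'_surjective

/-- The image `α_L(L)` of `L` in its syntactic monoid. -/
def acceptingSet {A : Type*} (L : Language A) : Set (SyntacticMonoid L) :=
  syntacticHom L '' {w | w.toList ∈ L}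

theorem syntacticHom_eq_iff {A : Type*} (L : Language A) (u v : FreeMonoid A) :
    syntacticHom L u = syntacticHom L v ↔
      ∀ x y : FreeMonoid A, (x * u * y).toList ∈ L ↔ (x * v * y).toList ∈ L :=
  (syntacticCon L).eq

theorem syntacticHom_mem_acceptingSet {A : Type*} (L : Language A) (w : FreeMonoid A) :
    syntacticHom L w ∈ acceptingSet L ↔ w.toList ∈ L := by
  constructor
  · rintro ⟨v, hv, hvw⟩
    have h := (syntacticHom_eq_iff L v w).1 hvw 1 1
    simp only [one_mul, mul_one] at h
    exact h.1 hv
  · exact fun h => ⟨w, h, rfl⟩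

/-- The syntactic order: `s ≤_L t` when `x s y ∈ α_L(L)` implies `x t y ∈ α_L(L)` for all
`x, y ∈ M_L`. -/
instance instPartialOrderSyntacticMonoid {A : Type*} (L : Language A) :
    PartialOrder (SyntacticMonoid L) where
  le s t := ∀ x y : SyntacticMonoid L, x * s * y ∈ acceptingSet L → x * t * y ∈ acceptingSet L
  le_refl _ _ _ h := h
  le_trans _ _ _ h₁ h₂ x y h := h₂ x y (h₁ x y h)
  le_antisymm s t h₁ h₂ := by
    obtain ⟨u, rfl⟩ := syntacticHom_surjective L s
    obtain ⟨v, rfl⟩ := syntacticHom_surjective L t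
    refine (syntacticHom_eq_iff L u v).2 fun x y => ?_
    rw [← syntacticHom_mem_acceptingSet, ← syntacticHom_mem_acceptingSet]
    simp only [map_mul]
    exact ⟨h₁ _ _, h₂ _ _⟩

/-- The syntactic monoid of a regular language is finite. -/
theorem finite_syntacticMonoid {A : Type*} {L : Language A} (hL : L.IsRegular) :
    Finite (SyntacticMonoid L) := by
  obtain ⟨σ, _, D, rfl⟩ := hL
  have key : ∀ u v : FreeMonoid A,
      (fun q => D.evalFrom q u.toList) = (fun q => D.evalFrom q v.toList) →
      syntacticHom D.accepts u = syntacticHom D.accepts v := by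
    intro u v h
    refine (syntacticHom_eq_iff _ u v).2 fun x y => ?_
    have hx := congrFun h (D.evalFrom D.start x.toList)
    simp only [FreeMonoid.toList_mul, DFA.mem_accepts, DFA.eval, DFA.evalFrom_of_append, hx]
  refine Finite.of_injective
    (fun s : SyntacticMonoid D.accepts => fun q : σ =>
      D.evalFrom q (Function.surjInv (syntacticHom_surjective D.accepts) s).toList) ?_
  intro s t h
  have hst := key _ _ h
  have hs := Function.surjInv_eq (syntacticHom_surjective D.accepts) s
  have ht := Function.surjInv_eq (syntacticHom_surjective D.accepts) t
  exact hs.symm.trans (hst.trans ht)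

/-! ### Idempotent powers -/

/-- The number `ω(M)`: the least positive integer `n` such that `s ^ n` is idempotent for
every `s ∈ M`. It exists whenever `M` is finite, see `omegaPow_spec`. -/
noncomputable def omegaPow (M : Type*) [Monoid M] : ℕ :=
  sInf {n : ℕ | 0 < n ∧ ∀ s : M, IsIdempotentElem (s ^ n)}

theorem omegaPow_spec (M : Type*) [Monoid M] [Finite M] :
    0 < omegaPow M ∧ ∀ s : M, IsIdempotentElem (s ^ omegaPow M) := by
  have key : ∀ s : M, ∃ n : ℕ, 0 < n ∧ IsIdempotentElem (s ^ n) := by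
    intro s
    obtain ⟨i, j, hij, h⟩ : ∃ i j : ℕ, i < j ∧ s ^ i = s ^ j := by
      obtain ⟨a, b, hne, hab⟩ := Finite.exists_ne_map_eq_of_infinite (fun n : ℕ => s ^ n)
      rcases lt_or_gt_of_ne hne with hlt | hlt
      · exact ⟨a, b, hlt, hab⟩
      · exact ⟨b, a, hlt, hab.symm⟩
    obtain ⟨p, rfl⟩ : ∃ p, j = i + p := ⟨j - i, by omega⟩
    have hp : 0 < p := by omega
    have per : ∀ m k : ℕ, i ≤ m → s ^ (m + p * k) = s ^ m := by
      intro m k hm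
      induction k with
      | zero => simp
      | succ k ih =>
        obtain ⟨d, rfl⟩ := Nat.exists_eq_add_of_le hm
        calc s ^ (i + d + p * (k + 1)) = s ^ (i + p) * s ^ (d + p * k) := by
              rw [← pow_add]; congr 1; ring
          _ = s ^ (i + d + p * k) := by rw [← h, ← pow_add]; congr 1; ring
          _ = s ^ (i + d) := ih
    refine ⟨p * (i + 1), by positivity, ?_⟩
    have := per (p * (i + 1)) (i + 1) (by nlinarith)
    rw [IsIdempotentElem, ← pow_add]
    exact this
  choose f hf hid using key
  have : Fintype M := Fintype.ofFinite M
  have hne : {n : ℕ | 0 < n ∧ ∀ s : M, IsIdempotentElem (s ^ n)}.Nonempty := by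
    refine ⟨∏ s, f s, Finset.prod_pos fun s _ => hf s, fun s => ?_⟩
    obtain ⟨k, hk⟩ := Finset.dvd_prod_of_mem f (Finset.mem_univ s)
    rw [hk, pow_mul]
    exact (hid s).pow k
  exact Nat.sInf_mem hne

end PolynomialClosure

namespace PolynomialClosure

open scoped Pointwise

section Factorization

/-- A family of sets of a monoid, closed under subsets, finite unions, products, and iteration
inside the fiber of an idempotent. -/
structure IsFactorizationFamily {F M : Type*} [Monoid F] [Monoid M] (α : F →* M)
    (P : Set F → Prop) : Prop where
  mono : ∀ {X Y : Set F}, X ⊆ Y → P Y → P X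
  one : P {1}
  union : ∀ {X Y : Set F}, P X → P Y → P (X ∪ Y)
  mul : ∀ {X Y : Set F}, P X → P Y → P (X * Y)
  closure : ∀ {X : Set F} (e : M), IsIdempotentElem e → (∀ x ∈ X, α x = e) → P X →
    P (Submonoid.closure X : Set F)

variable {F M : Type*} [Monoid F] [Monoid M] {α : F →* M} {P : Set F → Prop}

theorem mul_map_of_mem_closure {Y : Set F} {q : M} (h : ∀ y ∈ Y, q * α y = q) {w : F}
    (hw : w ∈ Submonoid.closure Y) : q * α w = q := by
  induction hw using Submonoid.closure_induction with
  | mem y hy => exact h y hy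
  | one => simp
  | mul x y _ _ hx hy => rw [map_mul, ← mul_assoc, hx, hy]

/-- Iteration over a set whose image is a band of left zeros. -/
theorem IsFactorizationFamily.closure_of_leftZeros (hP : IsFactorizationFamily α P)
    (Z : Set M) (hZ : Z.Finite) (hz : ∀ z ∈ Z, ∀ t ∈ Z, z * t = z) :
    ∀ X : Set F, P X → (∀ x ∈ X, α x ∈ Z) → P (Submonoid.closure X : Set F) := by
  induction Z, hZ using Set.Finite.induction_on with
  | empty =>
    intro X _ h
    have : X = ∅ := Set.eq_empty_of_forall_notMem h
    subst this
    simpa using hP.one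
  | @insert z Z _ _ ih =>
    intro X hX h
    set U : Submonoid F := Submonoid.closure {x ∈ X | α x ∈ Z} with hU
    have hPU : P (U : Set F) :=
      ih (fun a ha b hb => hz a (.inr ha) b (.inr hb)) _ (hP.mono (Set.sep_subset _ _) hX)
        fun x hx => hx.2
    have hzU : ∀ u ∈ U, z * α u = z := fun u hu =>
      mul_map_of_mem_closure (fun x hx => hz z (.inl rfl) _ (.inr hx.2)) hu
    set W : Set F := {x ∈ X | α x = z} * (U : Set F) with hW
    have hPW : P (Submonoid.closure W : Set F) := by
      refine hP.closure z (hz z (.inl rfl) z (.inl rfl)) ?_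
        (hP.mul (hP.mono (Set.sep_subset _ _) hX) hPU)
      rintro _ ⟨x, hx, u, hu, rfl⟩
      simp only [map_mul, hx.2, hzU u hu]
    refine hP.mono (fun w hw => ?_) (hP.mul hPU hPW)
    induction hw using Submonoid.closure_induction_left with
    | one => exact ⟨1, one_mem _, 1, one_mem _, one_mul 1⟩
    | mul_left x hx y _ ih =>
      obtain ⟨u, hu, b, hb, rfl⟩ := ih
      rcases h x hx with hxz | hxZ
      · exact ⟨1, one_mem _, x * u * b,
          mul_mem (Submonoid.subset_closure ⟨x, ⟨hx, hxz⟩, u, hu, rfl⟩) hb, by simp [mul_assoc]⟩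
      · exact ⟨x * u, mul_mem (Submonoid.subset_closure ⟨hx, hxZ⟩) hu, b, hb, mul_assoc _ _ _⟩

/-- The products of elements of `X` that, started in the state `p`, only visit states in `Q`. -/
inductive Run (α : F →* M) (X : Set F) (Q : Set M) (p : M) : F → Prop
  | one : Run α X Q p 1
  | snoc (w x : F) : Run α X Q p w → x ∈ X → p * α (w * x) ∈ Q → Run α X Q p (w * x)

/-- The runs from `p` that leave `Q` at the last step, and end in a state in `R`. -/
def exitRuns (α : F →* M) (X : Set F) (Q R : Set M) (p : M) : Set F :=
  {y | ∃ w x, Run α X Q p w ∧ x ∈ X ∧ p * α (w * x) ∈ R ∧ w * x = y}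

theorem Run.map_mem {X : Set F} {Q : Set M} {p : M} {N : Submonoid M}
    (hX : ∀ x ∈ X, α x ∈ N) {w : F} (hw : Run α X Q p w) : α w ∈ N := by
  induction hw with
  | one => simp
  | snoc w x _ hx _ ih => rw [map_mul]; exact mul_mem ih (hX x hx)

theorem IsFactorizationFamily.exitRuns (hP : IsFactorizationFamily α P) {X : Set F} (hX : P X)
    {Q : Set M} (R : Set M) {p : M} (h : P {w | Run α X Q p w}) : P (exitRuns α X Q R p) := by
  refine hP.mono ?_ (hP.mul h hX)
  rintro _ ⟨w, x, hw, hx, -, rfl⟩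
  exact ⟨w, hw, x, hx, rfl⟩

/-- Removing one state at a time: runs through states with small stabilizers. -/
theorem IsFactorizationFamily.run (hP : IsFactorizationFamily α P) {N : Submonoid M}
    {X : Set F} (hX : P X) (hXN : ∀ x ∈ X, α x ∈ N) {Q : Set M} (hQ : Q.Finite)
    (hstab : ∀ q ∈ Q, ∀ Y : Set F, P Y → (∀ y ∈ Y, α y ∈ N ∧ q * α y = q) →
      P (Submonoid.closure Y : Set F)) (p : M) : P {w | Run α X Q p w} := by
  induction Q, hQ using Set.Finite.induction_on generalizing p with
  | empty =>
    refine hP.mono ?_ hP.one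
    rintro _ (_ | ⟨w, x, _, _, h⟩)
    · rfl
    · exact h.elim
  | @insert q Q _ _ ih =>
    replace ih := ih fun r hr => hstab r (.inr hr)
    have hloop : P (Submonoid.closure (PolynomialClosure.exitRuns α X Q {q} q) : Set F) := by
      refine hstab q (.inl rfl) _ (hP.exitRuns hX _ (ih q)) ?_
      rintro _ ⟨w, x, hw, hx, h, rfl⟩
      exact ⟨by rw [map_mul]; exact mul_mem (hw.map_mem hXN) (hXN x hx), h⟩
    refine hP.mono ?_ (hP.union (ih p)
      (hP.mul (hP.mul (hP.exitRuns hX {q} (ih p)) hloop) (ih q)))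
    intro w hw
    induction hw with
    | one => exact .inl .one
    | snoc w x _ hx h ihw =>
      rcases ihw with hw | ⟨_, ⟨e, he, l, hl, rfl⟩, k, hk, rfl⟩
      · rcases h with h | h
        · exact .inr ⟨w * x, ⟨w * x, ⟨w, x, hw, hx, h, rfl⟩, 1, one_mem _, mul_one _⟩, 1, .one,
            mul_one _⟩
        · exact .inl (.snoc w x hw hx h)
      · have hl' : q * α l = q := mul_map_of_mem_closure
          (fun y hy => by obtain ⟨_, _, _, _, h', rfl⟩ := hy; exact h') hl
        have he' : p * α e = q := by obtain ⟨_, _, _, _, h', rfl⟩ := id he; exact h'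
        have hk' : p * α (e * l * k * x) = q * α (k * x) := by
          rw [mul_assoc (e * l), map_mul, map_mul, ← mul_assoc, ← mul_assoc, he', hl']
        replace h : q * α (k * x) ∈ insert q Q := hk' ▸ h
        rcases h with h | h
        · exact .inr ⟨e * (l * (k * x)), ⟨e, he, l * (k * x), mul_mem hl
            (Submonoid.subset_closure ⟨k, x, hk, hx, h, rfl⟩), rfl⟩, 1, .one,
            by simp [mul_assoc]⟩
        · exact .inr ⟨e * l, ⟨e, he, l, hl, rfl⟩, k * x, .snoc k x hk hx h,
            by simp [mul_assoc]⟩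

/-- A factorization family for a morphism to a finite monoid is closed under iteration. -/
theorem IsFactorizationFamily.closure_mem [Finite M] (hP : IsFactorizationFamily α P)
    (N : Submonoid M) : ∀ X : Set F, P X → (∀ x ∈ X, α x ∈ N) →
      P (Submonoid.closure X : Set F) := by
  induction N using WellFoundedLT.induction with
  | ind N ih =>
    intro X hX hXN
    set Z : Set M := {z | z ∈ N ∧ ∀ m ∈ N, z * m = z} with hZ
    have hrun : P {w | Run α X Zᶜ 1 w} := by
      have : P {w | Run α X ((N : Set M) \ Z) 1 w} := by
        refine hP.run hX hXN (Set.toFinite _) (fun q hq Y hY h => ?_) 1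
        obtain ⟨hqN, hqZ⟩ := hq
        obtain ⟨m, hm, hqm⟩ : ∃ m ∈ N, q * m ≠ q := by
          by_contra! hcon
          exact hqZ ⟨hqN, hcon⟩
        let N' : Submonoid M :=
          { carrier := {m | m ∈ N ∧ q * m = q}
            one_mem' := ⟨one_mem _, mul_one _⟩
            mul_mem' := fun ha hb => ⟨mul_mem ha.1 hb.1, by rw [← mul_assoc, ha.2, hb.2]⟩ }
        refine ih N' (lt_of_le_of_ne (fun m hm => hm.1) ?_) Y hY h
        intro heq
        have : m ∈ N' := heq ▸ hm
        exact hqm this.2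
      refine hP.mono (fun w hw => ?_) this
      induction hw with
      | one => exact .one
      | snoc w x hw hx h ihw =>
        refine .snoc w x ihw hx ⟨?_, h⟩
        rw [one_mul, map_mul]
        exact mul_mem (hw.map_mem hXN) (hXN x hx)
    have hexit : P (Submonoid.closure (PolynomialClosure.exitRuns α X Zᶜ Z 1) : Set F) := by
      refine hP.closure_of_leftZeros Z (Set.toFinite _) (fun z hz t ht => hz.2 t ht.1) _
        (hP.exitRuns hX _ hrun) ?_
      rintro _ ⟨w, x, _, _, h, rfl⟩
      rwa [one_mul] at h
    refine hP.mono (fun w hw => ?_) (hP.mul hexit hrun)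
    induction hw using Submonoid.closure_induction_right with
    | one => exact ⟨1, one_mem _, 1, .one, one_mul 1⟩
    | mul_right w _ x hx ihw =>
      obtain ⟨y, hy, k, hk, rfl⟩ := ihw
      by_cases h : 1 * α (k * x) ∈ Z
      · exact ⟨y * (k * x), mul_mem hy (Submonoid.subset_closure ⟨k, x, hk, hx, h, rfl⟩), 1, .one,
          by simp [mul_assoc]⟩
      · exact ⟨y, hy, k * x, .snoc k x hk hx h, (mul_assoc _ _ _).symm⟩

end Factorization

section PolClosureProperties

variable {A : Type*} {C : Set (Language A)}

theorem toList_mem_markedConcat {K L : Language A} {a : A} {w : FreeMonoid A} :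
    w.toList ∈ markedConcat K a L ↔
      ∃ p q : FreeMonoid A, p.toList ∈ K ∧ q.toList ∈ L ∧ p * .of a * q = w := by
  constructor
  · rintro ⟨_, ⟨p, hp, _, rfl, rfl⟩, q, hq, h⟩
    exact ⟨.ofList p, .ofList q, hp, hq, h⟩
  · rintro ⟨p, q, hp, hq, rfl⟩
    exact ⟨_, ⟨p.toList, hp, _, rfl, rfl⟩, q.toList, hq, rfl⟩

theorem mul_eq_mul_of_mul {w₁ w₂ p q : FreeMonoid A} {a : A} (h : w₁ * w₂ = p * .of a * q) :
    (∃ c, p = w₁ * c ∧ w₂ = c * .of a * q) ∨ (∃ c, w₁ = p * .of a * c ∧ q = c * w₂) := by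
  rw [mul_assoc] at h
  rcases List.append_eq_append_iff.1 (show w₁.toList ++ w₂.toList = p.toList ++ a :: q.toList from h)
    with ⟨c, h₁, h₂⟩ | ⟨c, h₁, h₂⟩
  · exact .inl ⟨.ofList c, h₁, by rw [mul_assoc]; exact h₂⟩
  · cases c with
    | nil => exact .inl ⟨1, by simpa using h₁.symm, h₂.symm⟩
    | cons b c =>
      obtain ⟨rfl, h₃⟩ := List.cons.inj h₂
      exact .inr ⟨.ofList c, by rw [mul_assoc]; exact h₁, h₃⟩

theorem finite_quotients {L : Language A} (hL : L.IsRegular) :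
    (Set.range fun p : FreeMonoid A × FreeMonoid A =>
      rightQuotient (L.leftQuotient p.1.toList) p.2.toList).Finite := by
  have := finite_syntacticMonoid hL
  refine (Set.finite_range fun p : SyntacticMonoid L × SyntacticMonoid L =>
    ({w | p.1 * syntacticHom L (.ofList w) * p.2 ∈ acceptingSet L} : Language A)).subset ?_
  rintro _ ⟨⟨x, y⟩, rfl⟩
  refine ⟨(syntacticHom L x, syntacticHom L y), ?_⟩
  ext w
  change _ ∈ acceptingSet L ↔ x.toList ++ (w ++ y.toList) ∈ L
  rw [← map_mul, ← map_mul, syntacticHom_mem_acceptingSet, mul_assoc]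
  rfl

/-- Replacing a factor `u` inside a large power of `u`, in a language of `Pol(C)`. -/
theorem MemPol.exists_pow_insert (hC : IsRegularQuotientingLattice C) {K : Language A}
    (hK : MemPol C K) : ∃ S ⊆ C, S.Finite ∧ ∃ k > 0, ∀ n > 0, ∀ x u y v : FreeMonoid A,
      (∀ H ∈ S, u.toList ∈ H → v.toList ∈ H) → (x * u ^ (n * k + 1) * y).toList ∈ K →
        ∃ i > 0, ∃ j > 0, (x * u ^ (n * i) * v * u ^ (n * j) * y).toList ∈ K := by
  induction hK with
  | base K hK =>
    refine ⟨_, ?_, finite_quotients (hC.isRegular K hK), 2, two_pos, ?_⟩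
    · rintro _ ⟨p, rfl⟩
      exact hC.isQuotienting.rightQuotient_mem _ (hC.isQuotienting.leftQuotient_mem _ hK _) _
    · intro n _ x u y v huv h
      refine ⟨1, one_pos, 1, one_pos, ?_⟩
      have key : ∀ w : FreeMonoid A,
          w.toList ∈ rightQuotient (K.leftQuotient (x * u ^ n).toList) (u ^ n * y).toList ↔
            (x * u ^ n * w * u ^ n * y).toList ∈ K := by
        intro w
        rw [mul_assoc _ (u ^ n) y, mul_assoc _ w]
        rfl
      rw [mul_one, ← key]
      refine huv _ ⟨(x * u ^ n, u ^ n * y), rfl⟩ ((key u).2 ?_)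
      convert h using 3
      rw [mul_two, add_assoc, pow_add, pow_succ']
      simp only [mul_assoc]
  | union K L _ _ ihK ihL =>
    obtain ⟨S, hSC, hS, k, hk, h₁⟩ := ihK
    obtain ⟨T, hTC, hT, l, hl, h₂⟩ := ihL
    refine ⟨S ∪ T, Set.union_subset hSC hTC, hS.union hT, k * l, by positivity, ?_⟩
    rintro n hn x u y v huv (h | h)
    · obtain ⟨i, hi, j, hj, h⟩ := h₁ (n * l) (by positivity) x u y v
        (fun H hH => huv H (.inl hH)) (by rwa [mul_assoc n, mul_comm l])
      rw [mul_assoc n, mul_assoc n] at h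
      exact ⟨l * i, by positivity, l * j, by positivity, .inl h⟩
    · obtain ⟨i, hi, j, hj, h⟩ := h₂ (n * k) (by positivity) x u y v
        (fun H hH => huv H (.inr hH)) (by rwa [mul_assoc n])
      rw [mul_assoc n, mul_assoc n] at h
      exact ⟨k * i, by positivity, k * j, by positivity, .inr h⟩
  | marked K a L _ _ ihK ihL =>
    obtain ⟨S, hSC, hS, k, hk, h₁⟩ := ihK
    obtain ⟨T, hTC, hT, l, hl, h₂⟩ := ihL
    refine ⟨S ∪ T, Set.union_subset hSC hTC, hS.union hT, 3 * (k * l), by positivity, ?_⟩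
    intro n hn x u y v huv h
    obtain ⟨p, q, hp, hq, hpq⟩ := toList_mem_markedConcat.1 h
    obtain ⟨m, hm⟩ : ∃ m, n * (k * l) = m + 1 := Nat.exists_eq_succ_of_ne_zero (by positivity)
    have hsplit : x * u ^ (n * (3 * (k * l)) + 1) * y =
        (x * u ^ (n * (k * l) + 1)) * (u ^ (2 * (n * (k * l))) * y) := by
      rw [show n * (3 * (k * l)) + 1 = (n * (k * l) + 1) + 2 * (n * (k * l)) by ring,
        pow_add u (n * (k * l) + 1)]
      simp only [mul_assoc]
    rcases mul_eq_mul_of_mul (hsplit.symm.trans hpq.symm) with ⟨c, rfl, hc⟩ | ⟨c, hc, rfl⟩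
    · obtain ⟨i, hi, j, hj, h⟩ := h₁ (n * l) (by positivity) x u c v
        (fun H hH => huv H (.inl hH)) (by rwa [mul_assoc n, mul_comm l])
      refine ⟨l * i, by positivity, l * j + 2 * (k * l), by positivity,
        toList_mem_markedConcat.2 ⟨_, q, h, hq, ?_⟩⟩
      have e : n * (l * j + 2 * (k * l)) = n * l * j + 2 * (n * (k * l)) := by ring
      rw [e, pow_add, ← mul_assoc n, mul_assoc (_ * v) _ y, mul_assoc (u ^ _) _ y, hc]
      simp only [mul_assoc]
    · obtain ⟨i, hi, j, hj, h⟩ := h₂ (n * k) (by positivity) (c * u ^ m) u y v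
        (fun H hH => huv H (.inr hH)) (by
          convert hq using 2
          rw [mul_assoc c, ← pow_add, mul_assoc c]
          congr 3
          rw [mul_assoc n, hm]
          ring)
      refine ⟨k * i + 2 * (k * l), by positivity, k * j, by positivity,
        toList_mem_markedConcat.2 ⟨p, _, hp, h, ?_⟩⟩
      have e : n * (k * i + 2 * (k * l)) = (n * (k * l) + 1) + (m + n * k * i) := by
        rw [mul_add, mul_left_comm n 2, hm]; ring
      rw [e, pow_add u (n * (k * l) + 1), ← mul_assoc x, hc, pow_add, ← mul_assoc n]
      simp only [mul_assoc]

theorem finite_biInter_mem (hC : IsLatticeClass C) {ι : Type*} {T : Set ι} (hT : T.Finite)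
    (f : ι → Language A) (hf : ∀ i ∈ T, f i ∈ C) :
    ∃ K ∈ C, ∀ w, w ∈ K ↔ ∀ i ∈ T, w ∈ f i := by
  induction T, hT using Set.Finite.induction_on with
  | empty => exact ⟨⊤, hC.univ_mem, fun w => ⟨fun _ i hi => hi.elim, fun _ => trivial⟩⟩
  | @insert i T _ _ ih =>
    obtain ⟨K, hK, h⟩ := ih fun j hj => hf j (.inr hj)
    refine ⟨f i ⊓ K, hC.inter_mem _ (hf i (.inl rfl)) _ hK, fun w => ?_⟩
    rw [Set.forall_mem_insert, ← h]
    rfl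

theorem finite_biUnion_mem (hC : IsLatticeClass C) {ι : Type*} {T : Set ι} (hT : T.Finite)
    (f : ι → Language A) (hf : ∀ i ∈ T, f i ∈ C) :
    ∃ K ∈ C, ∀ w, w ∈ K ↔ ∃ i ∈ T, w ∈ f i := by
  induction T, hT using Set.Finite.induction_on with
  | empty => exact ⟨⊥, hC.empty_mem, fun w => ⟨fun h => h.elim, fun ⟨_, h, _⟩ => h.elim⟩⟩
  | @insert i T _ _ ih =>
    obtain ⟨K, hK, h⟩ := ih fun j hj => hf j (.inr hj)
    refine ⟨f i ⊔ K, hC.union_mem _ (hf i (.inl rfl)) _ hK, fun w => ?_⟩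
    rw [Set.exists_mem_insert, ← h]
    rfl

theorem MemPol.finite_biUnion (hC : IsLatticeClass C) {ι : Type*} {T : Set ι} (hT : T.Finite)
    (f : ι → Language A) (hf : ∀ i ∈ T, MemPol C (f i)) :
    ∃ K, MemPol C K ∧ ∀ w, w ∈ K ↔ ∃ i ∈ T, w ∈ f i := by
  induction T, hT using Set.Finite.induction_on with
  | empty => exact ⟨⊥, .base _ hC.empty_mem, fun w => ⟨fun h => h.elim, fun ⟨_, h, _⟩ => h.elim⟩⟩
  | @insert i T _ _ ih =>
    obtain ⟨K, hK, h⟩ := ih fun j hj => hf j (.inr hj)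
    refine ⟨f i ⊔ K, .union _ _ (hf i (.inl rfl)) hK, fun w => ?_⟩
    rw [Set.exists_mem_insert, ← h]
    rfl

/-- A `C`-pair contains words `u`, `v` that a given finite part of `C` does not separate. -/
theorem IsCPair.exists_words (hC : IsLatticeClass C) {M : Type*} [Monoid M]
    {α : FreeMonoid A →* M} {s t : M} (h : IsCPair C α s t) {S : Set (Language A)} (hSC : S ⊆ C)
    (hS : S.Finite) : ∃ u v : FreeMonoid A, α u = s ∧ α v = t ∧
      ∀ H ∈ S, u.toList ∈ H → v.toList ∈ H := by
  by_contra! hcon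
  have hup : ∀ T ∈ 𝒫 S, ∃ K ∈ C, ∀ w : List A, w ∈ K ↔ ∀ H ∈ T, w ∈ H := fun T hT =>
    finite_biInter_mem hC (hS.subset hT) id fun H hH => hSC (hT hH)
  choose! f hfC hf using hup
  obtain ⟨K, hKC, hK⟩ := finite_biUnion_mem hC
    (T := {T | T ⊆ S ∧ ∃ u : FreeMonoid A, α u = s ∧ T = {H ∈ S | u.toList ∈ H}})
    (hS.finite_subsets.subset fun T hT => hT.1) f fun T hT => hfC T hT.1
  refine h ⟨K, hKC, fun u hu => (hK u).2 ?_, ?_⟩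
  · exact ⟨{H ∈ S | (u : List A) ∈ H}, ⟨Set.sep_subset _ _, .ofList u, hu, rfl⟩,
      (hf _ (Set.sep_subset _ _) u).2 fun H hH => hH.2⟩
  · refine le_bot_iff.1 fun v hv => ?_
    obtain ⟨_, ⟨hT, u, hu, rfl⟩, hvT⟩ := (hK v).1 hv.2
    obtain ⟨H, hH, huH, hvH⟩ := hcon u (.ofList v) hu hv.1
    exact (hvH ((hf _ hT v).1 hvT H ⟨hH, huH⟩)).elim

theorem MemPol.leftQuotient_singleton (hC : IsQuotientingClass C) {L : Language A}
    (hL : MemPol C L) (a : A) : MemPol C (L.leftQuotient [a]) := by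
  induction hL with
  | base L hL => exact .base _ (hC.leftQuotient_mem L hL [a])
  | union K L _ _ ihK ihL => exact .union _ _ ihK ihL
  | marked K b L hK hL ihK ihL =>
    have key : ∀ w : FreeMonoid A, w.toList ∈ (markedConcat K b L).leftQuotient [a] ↔
        w.toList ∈ markedConcat (K.leftQuotient [a]) b L ∨ ([] ∈ K ∧ a = b ∧ w.toList ∈ L) := by
      intro w
      change (FreeMonoid.of a * w).toList ∈ markedConcat K b L ↔ _
      rw [toList_mem_markedConcat, toList_mem_markedConcat]
      constructor
      · rintro ⟨p, q, hp, hq, h⟩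
        rw [mul_assoc] at h
        replace h : p.toList ++ (b :: q.toList) = a :: w.toList := h
        rcases List.append_eq_cons_iff.1 h with ⟨h₁, h₂⟩ | ⟨p', h₁, h₂⟩
        · obtain ⟨rfl, h₃⟩ := List.cons.inj h₂
          exact .inr ⟨h₁ ▸ hp, rfl, by rwa [← h₃]⟩
        · exact .inl ⟨.ofList p', q, by rw [h₁] at hp; exact hp, hq,
            by rw [mul_assoc]; exact h₂.symm⟩
      · rintro (⟨p, q, hp, hq, rfl⟩ | ⟨h, rfl, hw⟩)
        · exact ⟨.of a * p, q, hp, hq, by simp only [mul_assoc]⟩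
        · exact ⟨1, w, h, hw, by simp⟩
    by_cases h : [] ∈ K ∧ a = b
    · have : (markedConcat K b L).leftQuotient [a] = markedConcat (K.leftQuotient [a]) b L ⊔ L := by
        ext w
        refine (key (.ofList w)).trans ?_
        simp only [h, true_and]
        rfl
      rw [this]
      exact .union _ _ (.marked _ _ _ ihK hL) hL
    · have : (markedConcat K b L).leftQuotient [a] = markedConcat (K.leftQuotient [a]) b L := by
        ext w
        refine (key (.ofList w)).trans ?_
        simp only [← and_assoc, h, false_and, or_false]
        rfl
      rw [this]
      exact .marked _ _ _ ihK hL

theorem MemPol.mul [Finite A] (hC : IsRegularQuotientingLattice C) {K L : Language A}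
    (hK : MemPol C K) (hL : MemPol C L) : MemPol C (K * L) := by
  classical
  obtain ⟨H, hH, h⟩ := MemPol.finite_biUnion hC.isLattice (Set.toFinite (Set.univ : Set A))
    (fun a => markedConcat K a (L.leftQuotient [a]))
    fun a _ => .marked _ _ _ hK (hL.leftQuotient_singleton hC.isQuotienting a)
  have hE : MemPol C (if [] ∈ L then K else ⊥) := by
    split_ifs
    exacts [hK, .base _ hC.isLattice.empty_mem]
  have key : K * L = H ⊔ (if [] ∈ L then K else ⊥) := by
    ext w
    change _ ↔ w ∈ H ∨ w ∈ _
    rw [h]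
    constructor
    · rintro ⟨x, hx, _ | ⟨a, y⟩, hy, rfl⟩
      · right
        change x ++ [] ∈ (if [] ∈ L then K else ⊥ : Language A)
        rwa [if_pos (show [] ∈ L from hy), List.append_nil]
      · exact .inl ⟨a, trivial, (toList_mem_markedConcat (w := .ofList (x ++ a :: y))).2
          ⟨.ofList x, .ofList y, hx, hy, by rw [mul_assoc]; rfl⟩⟩
    · rintro (⟨a, -, h⟩ | h)
      · obtain ⟨p, q, hp, hq, h⟩ := (toList_mem_markedConcat (w := .ofList w)).1 h
        rw [mul_assoc] at h
        exact ⟨p.toList, hp, a :: q.toList, hq, h⟩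
      · split_ifs at h with hL
        · exact ⟨w, h, [], hL, by simp⟩
        · exact h.elim
  rw [key]
  exact .union _ _ hH hE

end PolClosureProperties

section Covers

variable {A : Type*} {C : Set (Language A)} {L : Language A}

theorem SyntacticMonoid.mul_le_mul {s s' t t' : SyntacticMonoid L} (h : s ≤ s') (h' : t ≤ t') :
    s * t ≤ s' * t' := by
  intro x y hxy
  have h₁ := h x (t * y) (by simpa only [mul_assoc] using hxy)
  have h₂ := h' (x * s') y (by simpa only [mul_assoc] using h₁)
  simpa only [mul_assoc] using h₂

/-- For all `s`, the words of `X` of image `s` lie in a language of `Pol(C)` all of whose words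
have an image below `s`. -/
def Covered (C : Set (Language A)) (L : Language A) (X : Set (FreeMonoid A)) : Prop :=
  ∀ s : SyntacticMonoid L, ∃ H, MemPol C H ∧
    (∀ w ∈ X, syntacticHom L w = s → w.toList ∈ H) ∧
      ∀ w : FreeMonoid A, w.toList ∈ H → syntacticHom L w ≤ s

theorem Covered.of_single (hC : IsLatticeClass C) {X : Set (FreeMonoid A)} (s : SyntacticMonoid L)
    (hX : ∀ w ∈ X, syntacticHom L w = s) {H : Language A} (hH : MemPol C H)
    (hXH : ∀ w ∈ X, w.toList ∈ H) (hs : ∀ w : FreeMonoid A, w.toList ∈ H → syntacticHom L w ≤ s) :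
    Covered C L X := by
  intro t
  by_cases hst : s = t
  · subst hst
    exact ⟨H, hH, fun w hw _ => hXH w hw, hs⟩
  · exact ⟨⊥, .base _ hC.empty_mem, fun w hw h => (hst ((hX w hw).symm.trans h)).elim,
      fun w hw => hw.elim⟩

theorem Covered.mono {X Y : Set (FreeMonoid A)} (h : X ⊆ Y) (hY : Covered C L Y) :
    Covered C L X := by
  intro s
  obtain ⟨H, hH, h₁, h₂⟩ := hY s
  exact ⟨H, hH, fun w hw => h₁ w (h hw), h₂⟩

theorem Covered.union {X Y : Set (FreeMonoid A)} (hX : Covered C L X) (hY : Covered C L Y) :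
    Covered C L (X ∪ Y) := by
  intro s
  obtain ⟨H, hH, h₁, h₂⟩ := hX s
  obtain ⟨K, hK, h₃, h₄⟩ := hY s
  refine ⟨H ⊔ K, .union _ _ hH hK, ?_, ?_⟩
  · rintro w (hw | hw) hs
    exacts [.inl (h₁ w hw hs), .inr (h₃ w hw hs)]
  · rintro w (hw | hw)
    exacts [h₂ w hw, h₄ w hw]

theorem Covered.mul [Finite A] (hC : IsRegularQuotientingLattice C) (hL : L.IsRegular)
    {X Y : Set (FreeMonoid A)} (hX : Covered C L X) (hY : Covered C L Y) :
    Covered C L (X * Y) := by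
  have := finite_syntacticMonoid hL
  intro s
  choose f hf hf₁ hf₂ using hX
  choose g hg hg₁ hg₂ using hY
  obtain ⟨H, hH, h⟩ := MemPol.finite_biUnion hC.isLattice
    (Set.toFinite {p : SyntacticMonoid L × SyntacticMonoid L | p.1 * p.2 = s})
    (fun p => f p.1 * g p.2) fun p _ => (hf p.1).mul hC (hg p.2)
  refine ⟨H, hH, ?_, ?_⟩
  · rintro _ ⟨x, hx, y, hy, rfl⟩ hs
    exact (h _).2 ⟨(syntacticHom L x, syntacticHom L y), by simpa using hs,
      x.toList, hf₁ _ x hx rfl, y.toList, hg₁ _ y hy rfl, rfl⟩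
  · intro w hw
    obtain ⟨⟨t, t'⟩, rfl, x, hx, y, hy, hxy⟩ := (h _).1 hw
    obtain rfl : FreeMonoid.ofList x * FreeMonoid.ofList y = w := hxy
    rw [map_mul]
    exact SyntacticMonoid.mul_le_mul (hf₂ t (.ofList x) hx) (hg₂ t' (.ofList y) hy)

theorem exists_mem_of_isCPair (hC : IsLatticeClass C) {M : Type*} [Monoid M] [Finite M]
    (α : FreeMonoid A →* M) (s : M) : ∃ K ∈ C, (∀ w : FreeMonoid A, α w = s → w.toList ∈ K) ∧
      ∀ w : FreeMonoid A, w.toList ∈ K → IsCPair C α s (α w) := by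
  have hsep : ∀ t ∈ {t | ¬ IsCPair C α s t}, ∃ K ∈ C, Separates K (fiber α s) (fiber α t) :=
    fun t ht => not_not.1 ht
  choose! f hfC hf using hsep
  obtain ⟨K, hKC, hK⟩ := finite_biInter_mem hC (Set.toFinite {t | ¬ IsCPair C α s t}) f hfC
  refine ⟨K, hKC, fun w hw => (hK _).2 fun t ht => (hf t ht).1 hw, fun w hw => ?_⟩
  by_contra hcon
  have : w.toList ∈ fiber α (α w) ⊓ f (α w) := ⟨rfl, (hK _).1 hw _ hcon⟩
  rw [(hf _ hcon).2] at this
  exact this.elim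

theorem covered_one [Finite (SyntacticMonoid L)] (hC : IsLatticeClass C)
    (h : ∀ e t : SyntacticMonoid L, IsIdempotentElem e → IsCPair C (syntacticHom L) e t →
      e * t * e ≤ e) : Covered C L {1} := by
  obtain ⟨K, hKC, hK, hpair⟩ := exists_mem_of_isCPair hC (syntacticHom L) 1
  refine .of_single hC 1 (by simp) (.base K hKC) (fun w hw => hK w (hw ▸ map_one _))
    fun w hw => ?_
  simpa using h 1 _ .one (hpair w hw)

theorem covered_of [Finite (SyntacticMonoid L)] (hC : IsLatticeClass C)
    (h : ∀ e t : SyntacticMonoid L, IsIdempotentElem e → IsCPair C (syntacticHom L) e t →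
      e * t * e ≤ e) (a : A) : Covered C L {.of a} := by
  obtain ⟨K, hKC, hK, hpair⟩ := exists_mem_of_isCPair hC (syntacticHom L) 1
  have hle : ∀ w : FreeMonoid A, w.toList ∈ K → syntacticHom L w ≤ 1 := fun w hw => by
    simpa using h 1 _ .one (hpair w hw)
  refine .of_single hC (syntacticHom L (.of a)) (by simp)
    (.marked K a K (.base K hKC) (.base K hKC)) ?_ fun w hw => ?_
  · rintro _ rfl
    exact toList_mem_markedConcat.2 ⟨1, 1, hK 1 (map_one _), hK 1 (map_one _), by simp⟩
  · obtain ⟨p, q, hp, hq, rfl⟩ := toList_mem_markedConcat.1 hw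
    simpa using SyntacticMonoid.mul_le_mul (SyntacticMonoid.mul_le_mul (hle p hp) le_rfl) (hle q hq)

theorem Covered.closure [Finite A] (hC : IsRegularQuotientingLattice C) (hL : L.IsRegular)
    (h : ∀ e t : SyntacticMonoid L, IsIdempotentElem e → IsCPair C (syntacticHom L) e t →
      e * t * e ≤ e) {X : Set (FreeMonoid A)} (e : SyntacticMonoid L) (he : IsIdempotentElem e)
    (hXe : ∀ x ∈ X, syntacticHom L x = e) (hX : Covered C L X) :
    Covered C L (Submonoid.closure X : Set (FreeMonoid A)) := by
  have := finite_syntacticMonoid hL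
  obtain ⟨K, hKC, hK, hpair⟩ := exists_mem_of_isCPair hC.isLattice (syntacticHom L) e
  obtain ⟨H, hH, hXH, hHe⟩ := hX e
  have hmid : Covered C L (X * {w | syntacticHom L w = e} * X) := by
    refine .of_single hC.isLattice e ?_ ((hH.mul hC (.base K hKC)).mul hC hH) ?_ ?_
    · rintro _ ⟨_, ⟨x, hx, w, hw, rfl⟩, y, hy, rfl⟩
      rw [map_mul, map_mul, hXe x hx, hXe y hy, show syntacticHom L w = e from hw, he.eq, he.eq]
    · rintro _ ⟨_, ⟨x, hx, w, hw, rfl⟩, y, hy, rfl⟩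
      exact ⟨_, ⟨x.toList, hXH x hx (hXe x hx), w.toList, hK w hw, rfl⟩, y.toList,
        hXH y hy (hXe y hy), rfl⟩
    · rintro _ ⟨_, ⟨x, hx, v, hv, rfl⟩, y, hy, rfl⟩
      change syntacticHom L (.ofList x * .ofList v * .ofList y) ≤ e
      rw [map_mul, map_mul]
      exact (SyntacticMonoid.mul_le_mul (SyntacticMonoid.mul_le_mul (hHe (.ofList x) hx) le_rfl)
        (hHe (.ofList y) hy)).trans (h e _ he (hpair (.ofList v) hv))
  refine .mono (fun w hw => ?_)
    (((covered_one hC.isLattice h).union hX).union ((hX.mul hC hL hX).union hmid))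
  induction hw using Submonoid.closure_induction_right with
  | one => exact .inl (.inl rfl)
  | mul_right w _ y hy ih =>
    rcases ih with (rfl | hw) | (⟨x, hx, x', hx', rfl⟩ | ⟨_, ⟨x, hx, v, hv, rfl⟩, x', hx', rfl⟩)
    · exact .inl (.inr (by rwa [one_mul]))
    · exact .inr (.inl ⟨w, hw, y, hy, rfl⟩)
    · exact .inr (.inr ⟨_, ⟨x, hx, x', hXe x' hx', rfl⟩, y, hy, rfl⟩)
    · refine .inr (.inr ⟨_, ⟨x, hx, v * x', ?_, rfl⟩, y, hy, by simp only [mul_assoc]⟩)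
      change syntacticHom L (v * x') = e
      rw [map_mul, hXe x' hx', show syntacticHom L v = e from hv, he.eq]

theorem covered_univ [Finite A] (hC : IsRegularQuotientingLattice C) (hL : L.IsRegular)
    (h : ∀ e t : SyntacticMonoid L, IsIdempotentElem e → IsCPair C (syntacticHom L) e t →
      e * t * e ≤ e) : Covered C L Set.univ := by
  have := finite_syntacticMonoid hL
  have hP : IsFactorizationFamily (syntacticHom L) (Covered C L) :=
    { mono := Covered.mono
      one := covered_one hC.isLattice h
      union := Covered.union
      mul := Covered.mul hC hL
      closure := Covered.closure hC hL h }
  have hletters : ∀ T : Set A, Covered C L (FreeMonoid.of '' T) := fun T => by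
    induction T, T.toFinite using Set.Finite.induction_on with
    | empty => exact hP.mono (by simp) hP.one
    | @insert a T _ _ ih =>
      rw [Set.image_insert_eq, Set.insert_eq]
      exact (covered_of hC.isLattice h a).union ih
  have := hP.closure_mem ⊤ _ (hletters Set.univ) fun _ _ => trivial
  rwa [Set.image_univ, FreeMonoid.closure_range_of] at this

theorem mem_coPol_of_idempotent [Finite A] (hC : IsRegularQuotientingLattice C)
    (hL : L.IsRegular) (h : ∀ e t : SyntacticMonoid L, IsIdempotentElem e →
      IsCPair C (syntacticHom L) e t → e * t * e ≤ e) : L ∈ coPol C := by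
  have := finite_syntacticMonoid hL
  choose f hf hf₁ hf₂ using covered_univ hC hL h
  obtain ⟨K, hK, hw⟩ := MemPol.finite_biUnion hC.isLattice
    (Set.toFinite (acceptingSet L)ᶜ) f fun s _ => hf s
  have : Lᶜ = K := by
    ext w
    rw [hw]
    constructor
    · intro hwL
      exact ⟨syntacticHom L (.ofList w),
        fun hmem => hwL ((syntacticHom_mem_acceptingSet L (.ofList w)).1 hmem),
        hf₁ _ (.ofList w) trivial rfl⟩
    · rintro ⟨s, hs, hws⟩ hwL
      have := hf₂ s (.ofList w) hws 1 1
      simp only [one_mul, mul_one] at this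
      exact hs (this ((syntacticHom_mem_acceptingSet L (.ofList w)).2 hwL))
  change MemPol C Lᶜ
  rwa [this]

theorem le_of_mem_coPol (hC : IsRegularQuotientingLattice C) (hL : L.IsRegular)
    (h : L ∈ coPol C) (s t : SyntacticMonoid L) (hst : IsCPair C (syntacticHom L) s t) :
    s ^ omegaPow (SyntacticMonoid L) * t * s ^ omegaPow (SyntacticMonoid L) ≤
      s ^ (omegaPow (SyntacticMonoid L) + 1) := by
  have := finite_syntacticMonoid hL
  obtain ⟨hω, hid⟩ := omegaPow_spec (SyntacticMonoid L)
  set ω := omegaPow (SyntacticMonoid L)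
  obtain ⟨S, hSC, hS, k, hk, hins⟩ := MemPol.exists_pow_insert hC h
  obtain ⟨u, v, rfl, rfl, huv⟩ := hst.exists_words hC.isLattice hSC hS
  have hpow : ∀ i > 0, syntacticHom L u ^ (ω * i) = syntacticHom L u ^ ω := fun i hi => by
    obtain ⟨i, rfl⟩ := Nat.exists_eq_succ_of_ne_zero hi.ne'
    rw [pow_mul]
    exact (hid _).pow_succ_eq i
  intro a b hab
  obtain ⟨x, rfl⟩ := syntacticHom_surjective L a
  obtain ⟨y, rfl⟩ := syntacticHom_surjective L b
  by_contra hcon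
  have hmem : (x * u ^ (ω * k + 1) * y).toList ∈ Lᶜ := by
    refine fun hL' => hcon ?_
    replace hL' := (syntacticHom_mem_acceptingSet L _).2 hL'
    rwa [map_mul, map_mul, map_pow, pow_succ, hpow k hk, ← pow_succ] at hL'
  obtain ⟨i, hi, j, hj, hij⟩ := hins ω hω x u y v huv hmem
  refine hij ((syntacticHom_mem_acceptingSet L _).1 ?_)
  simp only [map_mul, map_pow, hpow i hi, hpow j hj]
  simpa only [mul_assoc] using hab

end Covers

end PolynomialClosure

theorem mainTheorem5 {A : Type*} [Finite A] (C : Set (Language A))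
    (hC : PolynomialClosure.IsRegularQuotientingLattice C)
    (L : Language A) (hL : L.IsRegular) :
    List.TFAE [
      L ∈ PolynomialClosure.coPol C,
      ∀ s t : PolynomialClosure.SyntacticMonoid L,
        PolynomialClosure.IsCPair C (PolynomialClosure.syntacticHom L) s t →
          s ^ PolynomialClosure.omegaPow (PolynomialClosure.SyntacticMonoid L) * t *
              s ^ PolynomialClosure.omegaPow (PolynomialClosure.SyntacticMonoid L) ≤
            s ^ (PolynomialClosure.omegaPow (PolynomialClosure.SyntacticMonoid L) + 1),
      ∀ e t : PolynomialClosure.SyntacticMonoid L,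
        IsIdempotentElem e →
          PolynomialClosure.IsCPair C (PolynomialClosure.syntacticHom L) e t →
            e * t * e ≤ e] := by
  have := PolynomialClosure.finite_syntacticMonoid hL
  tfae_have 1 → 2 := PolynomialClosure.le_of_mem_coPol hC hL
  tfae_have 2 → 3 := by
    intro h e t he het
    obtain ⟨n, hn⟩ := Nat.exists_eq_succ_of_ne_zero
      (PolynomialClosure.omegaPow_spec (PolynomialClosure.SyntacticMonoid L)).1.ne'
    have := h e t het
    rwa [hn, he.pow_succ_eq, he.pow_succ_eq] at this
  tfae_have 3 → 1 := PolynomialClosure.mem_coPol_of_idempotent hC hL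
  tfae_finish
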